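/- Let $\mathbb{K}$ be $\mathbb{R}$ or $\mathbb{C}$. For $p,q\ge 0$ let $\mathfrak{Q}_{p,q}(0,\dots,0)$ be the quantum minimal surface algebra over $\mathbb{K}$ with zero spectrum, i.e. the quotient of the free Lie algebra on $x_1,\dots,x_{p+q}$ by the ideal generated by $$\sum_{i=1}^{p}[x_i,[x_i,x_j]]-\sum_{i=p+1}^{p+q}[x_i,[x_i,x_j]],\qquad j=1,\dots,p+q.$$ Let $n\ge 2$ and let $A\in\mathbb{Z}^{n\times n}$ be an irreducible, simply-laced generalized Cartan matrix of finite type. Let $\mathfrak{g}(A)$ be the Kac--Moody algebra of $A$ over $\mathbb{K}$ (given by Chevalley generators $e_i,f_i,h_i$, $1\le i\le n$, and the Serre relations), with root system $\Delta(A)$, simple roots $\alpha_1,\dots,\alpha_n$ (where $\alpha_j(h_i)=a_{ij}$), root spaces $\mathfrak{g}_\beta$ and highest root $\theta$. Let $m\ge 1$ and $p+q=n+m$. Let $0\ne e_\theta\in\mathfrak{g}_\theta$, and for $2\le j\le m$ let $\beta_j\in\Delta(A)\setminus\{-\theta,\alpha_1,\dots,\alpha_n\}$ and $e_{\beta_j}\in\mathfrak{g}_{\beta_j}$,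 where $\beta_i\ne-\beta_j$ for all $i\ne j$ (the $\beta_j$ need not be distinct). Then there exists a surjective Lie algebra homomorphism $\phi:\mathfrak{Q}_{p,q}(0,\dots,0)\to\mathfrak{g}(A)$ with $$\phi(x_i)=f_i\ \ (1\le i\le n),\qquad \phi(x_{n+1})=e_\theta,\qquad \phi(x_{n+j})=e_{\beta_j}\ \ (2\le j\le m).$$ -/

import Mathlib

noncomputable section

/-- Generalized Cartan matrices: `a_ii = 2`, and for `i ≠ j` both `a_ij ≤ 0` and
`a_ij = 0 ↔ a_ji = 0`. -/
structure IsGCM {n : ℕ} (A : Matrix (Fin n) (Fin n) ℤ) : Prop where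
  diag : ∀ i, A i i = 2
  nonpos : ∀ i j, i ≠ j → A i j ≤ 0
  zero_iff : ∀ i j, i ≠ j → (A i j = 0 ↔ A j i = 0)

/-- A matrix is of finite type if `D * A` is (symmetric and) positive definite for some diagonal
matrix `D` with positive diagonal entries. -/
def IsFiniteType {n : ℕ} (A : Matrix (Fin n) (Fin n) ℤ) : Prop :=
  ∃ d : Fin n → ℝ, (∀ i, 0 < d i) ∧ (Matrix.diagonal d * A.map (fun a : ℤ => (a : ℝ))).PosDef

/-- A matrix is indecomposable (irreducible) if its index set is not a disjoint union of two
nonempty sets with no nonzero entry from one to the other. For a generalized Cartan matrix this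
says that the Dynkin diagram is connected. -/
def IsIndecomposableMatrix {n : ℕ} (A : Matrix (Fin n) (Fin n) ℤ) : Prop :=
  ∀ S : Set (Fin n), S.Nonempty → Sᶜ.Nonempty → ∃ i ∈ S, ∃ j ∈ Sᶜ, A i j ≠ 0

section QMSA

variable (K : Type*) [Field K] (p q : ℕ) (μ : Fin (p + q) → K)

/-- The left side minus the right side of the `j`-th defining relation of the quantum minimal
surface algebra: the generators are `x_i`, `i : Fin (p + q)`, the first `p` of them enter with
sign `+` and the last `q` with sign `-`. -/
def qmsaRel (j : Fin (p + q)) : FreeLieAlgebra K (Fin (p + q)) :=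
  let x : Fin (p + q) → FreeLieAlgebra K (Fin (p + q)) := FreeLieAlgebra.of K
  (∑ i : Fin p, ⁅x (Fin.castAdd q i), ⁅x (Fin.castAdd q i), x j⁆⁆)
    - (∑ i : Fin q, ⁅x (Fin.natAdd p i), ⁅x (Fin.natAdd p i), x j⁆⁆) - μ j • x j

/-- The ideal of the free Lie algebra generated by the relations. -/
def qmsaIdeal : LieIdeal K (FreeLieAlgebra K (Fin (p + q))) :=
  LieSubmodule.lieSpan K _ (Set.range (qmsaRel K p q μ))

/-- The quantum minimal surface algebra of signature `(p, q)` and spectrum `μ` over `K`. -/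
abbrev QMSA : Type _ := FreeLieAlgebra K (Fin (p + q)) ⧸ qmsaIdeal K p q μ

/-- The generators of the quantum minimal surface algebra. -/
def QMSA.gen (i : Fin (p + q)) : QMSA K p q μ :=
  LieSubmodule.Quotient.mk (N := qmsaIdeal K p q μ) (FreeLieAlgebra.of K i)

end QMSA

namespace KacMoody

/- The Lie algebra `g(A)` over `K`, presented by the Chevalley generators and Serre relations, is
Mathlib's `A.ToLieAlgebra K`, that is `Matrix.ToLieAlgebra K A`. -/

variable (K : Type*) [Field K] {n : ℕ} (A : Matrix (Fin n) (Fin n) ℤ)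

/-- The Chevalley generators `h_i`. -/
def h (i : Fin n) : Matrix.ToLieAlgebra K A :=
  LieSubmodule.Quotient.mk (N := CartanMatrix.Relations.toIdeal K A)
    (FreeLieAlgebra.of K (CartanMatrix.Generators.H i))

/-- The Chevalley generators `f_i`. -/
def f (i : Fin n) : Matrix.ToLieAlgebra K A :=
  LieSubmodule.Quotient.mk (N := CartanMatrix.Relations.toIdeal K A)
    (FreeLieAlgebra.of K (CartanMatrix.Generators.F i))

/-- The simple root `α_i`, as an element of the root lattice `ℤ α_1 ⊕ ⋯ ⊕ ℤ α_n`, which is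
written in coordinates as `Fin n → ℤ`. -/
def simpleRoot (i : Fin n) : Fin n → ℤ := Pi.single i 1

/-- The root space `g_β` for `β = ∑ k_j α_j` in the root lattice: the elements on which each
`h_i` acts by `β(h_i) = ∑ k_j α_j(h_i) = ∑ a_ij k_j`. -/
def rootSpace (β : Fin n → ℤ) : Submodule K (Matrix.ToLieAlgebra K A) where
  carrier := {x | ∀ i, ⁅h K A i, x⁆ = ((∑ j, A i j * β j : ℤ) : K) • x}
  zero_mem' := fun i => by simp
  add_mem' := fun {x y} hx hy i => by rw [lie_add, hx i, hy i, smul_add]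
  smul_mem' := fun c x hx i => by rw [lie_smul, hx i, smul_comm]

/-- The roots of `g(A)`, the set `Δ(A)`: the nonzero elements of the root lattice with a nonzero
root space. -/
def roots : Set (Fin n → ℤ) := {β | β ≠ 0 ∧ rootSpace K A β ≠ ⊥}

/-- `θ` is the highest root: it is a root, and for each root `β` the difference `θ - β` is a
combination of simple roots with nonnegative coefficients. -/
def IsHighestRoot (θ : Fin n → ℤ) : Prop :=
  θ ∈ roots K A ∧ ∀ β ∈ roots K A, ∀ i, β i ≤ θ i

end KacMoody

end

/-! Every double bracket `⁅y i, ⁅y i, y j⁆⁆` of the proposed images vanishes on its own, so the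
signs and the signature `(p, q)` play no role. In the simply-laced finite case every root has norm 2
(`pairing_eq_two`). If `γ` and `δ` are roots with `γ ≠ -δ`, positivity of the norm of `γ + δ` gives
`(γ, δ) ≥ -1`, so `2γ + δ` has norm `10 + 4(γ, δ) ≥ 6` and is neither zero nor a root (`two_lt`,
`lie_lie_eq_zero`). The hypotheses say exactly that no two of the degrees `-α_i`, `θ`, `β_j` are
opposite.

For surjectivity, `e_θ` is killed by all `e_i`, so the span of the words in the `f_i` applied to it
is an ideal. It lies in the image, contains some `e_i`, and by connectedness of the diagram is
everything (`lieSpan_eq_top`).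

Norm 2 is proved without finite-dimensionality or a Weyl group action. If `γ ≠ α_i` is a positive
root with `k = γ(h_i) > 0`, then `(ad f_i)^k` is injective on its root space (`eq_zero_of_f_pow`),
so the reflected vector `γ - kα_i` is a positive root of the same norm and smaller height. The
descent ends at a simple root. -/

noncomputable section

/-! ### Serre systems, weight spaces and monomials -/

/-- Elements `e i`, `f i`, `h i` that generate the Lie algebra `L` and satisfy the Serre relations
of the simply-laced matrix `A`. -/
structure IsSerreSystem (K : Type*) [Field K] {ι L : Type*} [LieRing L] [LieAlgebra K L]
    (A : Matrix ι ι ℤ) (e f h : ι → L) : Prop where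
  hh : ∀ i j, ⁅h i, h j⁆ = 0
  ef_self : ∀ i, ⁅e i, f i⁆ = h i
  ef_ne : ∀ i j, i ≠ j → ⁅e i, f j⁆ = 0
  he : ∀ i j, ⁅h i, e j⁆ = (A i j : K) • e j
  hf : ∀ i j, ⁅h i, f j⁆ = -((A i j : K) • f j)
  ee : ∀ i j, i ≠ j → ⁅e i, ⁅e i, e j⁆⁆ = 0
  ff : ∀ i j, i ≠ j → ⁅f i, ⁅f i, f j⁆⁆ = 0
  gen : LieSubalgebra.lieSpan K L (Set.range e ∪ Set.range f) = ⊤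

/-- The simultaneous eigenspaces of the operators `ad (h i)`, for integral weights `A *ᵥ γ`. -/
def wtSpace (K : Type*) [Field K] {ι L : Type*} [Fintype ι] [LieRing L] [LieAlgebra K L]
    (A : Matrix ι ι ℤ) (h : ι → L) (γ : ι → ℤ) : Submodule K L where
  carrier := {x | ∀ i, ⁅h i, x⁆ = ((A.mulVec γ i : ℤ) : K) • x}
  zero_mem' := fun i => by simp
  add_mem' := fun {x y} hx hy i => by rw [lie_add, hx i, hy i, smul_add]
  smul_mem' := fun c x hx i => by rw [lie_smul, hx i, smul_comm]

/-- Right-normed iterated brackets of the `e i`, together with their degrees. -/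
inductive IsMonomial {ι L : Type*} [DecidableEq ι] [LieRing L] (e : ι → L) :
    (ι → ℤ) → L → Prop
  | single (i : ι) : IsMonomial e (Pi.single i 1) (e i)
  | cons (i : ι) {γ : ι → ℤ} {x : L} : IsMonomial e γ x →
      IsMonomial e (γ + Pi.single i 1) ⁅e i, x⁆

section Monomial

variable {ι L : Type*} [DecidableEq ι] [LieRing L] {e : ι → L} {γ : ι → ℤ} {x : L}

lemma IsMonomial.nonneg (hx : IsMonomial e γ x) : 0 ≤ γ := by
  induction hx with
  | single i => exact Pi.single_nonneg.2 zero_le_one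
  | cons i _ ih => exact add_nonneg ih (Pi.single_nonneg.2 zero_le_one)

/-- Degrees only grow, so all letters are `e i`, and a word of length at least two has `⁅e i, e i⁆ =
0` at its core. -/
lemma IsMonomial.of_support (hx : IsMonomial e γ x) (i : ι) (hi : ∀ j, j ≠ i → γ j = 0) :
    x = 0 ∨ (γ = Pi.single i 1 ∧ x = e i) := by
  induction hx with
  | single k =>
    by_cases hk : k = i
    · subst hk; exact Or.inr ⟨rfl, rfl⟩
    · have := hi k hk
      simp at this
  | @cons k γ x hx ih =>
    left
    have hki : k = i := by
      by_contra hk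
      have h1 := hi k hk
      have h2 := hx.nonneg k
      simp at h1 h2
      omega
    subst hki
    rcases ih (fun j hj => by simpa [hj] using hi j hj) with h0 | ⟨_, h0⟩
    · simp [h0]
    · simp [h0]

end Monomial

/-- The span of the monomials in the `e i`. -/
def monomialSpan (K : Type*) [Field K] {ι L : Type*} [DecidableEq ι] [LieRing L]
    [LieAlgebra K L] (e : ι → L) : Submodule K L :=
  Submodule.span K {x | ∃ γ, IsMonomial e γ x}

lemma lie_mem_monomialSpan {K : Type*} [Field K] {ι L : Type*} [DecidableEq ι]
    [LieRing L] [LieAlgebra K L] {e : ι → L} (i : ι) {x : L} (hx : x ∈ monomialSpan K e) :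
    ⁅e i, x⁆ ∈ monomialSpan K e := by
  have : monomialSpan K e ≤ (monomialSpan K e).comap (LieAlgebra.ad K L (e i)) := by
    rw [monomialSpan, Submodule.span_le]
    rintro y ⟨γ, hy⟩
    exact Submodule.subset_span ⟨_, hy.cons i⟩
  exact this hx

namespace IsSerreSystem

section General

variable {K : Type*} [Field K] {ι L : Type*} [LieRing L] [LieAlgebra K L]
  {A : Matrix ι ι ℤ} {e f h : ι → L}

lemma fe_self (S : IsSerreSystem K A e f h) (i : ι) : ⁅f i, e i⁆ = -h i := by
  rw [← lie_skew, S.ef_self]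

lemma fe_ne (S : IsSerreSystem K A e f h) (i j : ι) (hij : i ≠ j) : ⁅f i, e j⁆ = 0 := by
  rw [← lie_skew, S.ef_ne _ _ hij.symm, neg_zero]

/-- The Chevalley involution. -/
lemma flip (S : IsSerreSystem K A e f h) : IsSerreSystem K A f e (-h) where
  hh i j := by simp [S.hh]
  ef_self i := S.fe_self i
  ef_ne i j hij := S.fe_ne i j hij
  he i j := by simp [S.hf]
  hf i j := by simp [S.he]
  ee := S.ff
  ff := S.ee
  gen := by rw [Set.union_comm]; exact S.gen

/-- The Lie algebra acts through its generators. -/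
lemma lie_mem (S : IsSerreSystem K A e f h) (V : Submodule K L)
    (he : ∀ i, ∀ v ∈ V, ⁅e i, v⁆ ∈ V) (hf : ∀ i, ∀ v ∈ V, ⁅f i, v⁆ ∈ V) (y v : L) (hv : v ∈ V) :
    ⁅y, v⁆ ∈ V := by
  have hy : y ∈ LieSubalgebra.lieSpan K L (Set.range e ∪ Set.range f) := by simp [S.gen]
  induction hy using LieSubalgebra.lieSpan_induction generalizing v with
  | mem x hx =>
    rcases hx with ⟨i, rfl⟩ | ⟨i, rfl⟩
    · exact he i v hv
    · exact hf i v hv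
  | zero => simp
  | add x y _ _ hx hy => rw [add_lie]; exact V.add_mem (hx v hv) (hy v hv)
  | smul a x _ hx => rw [smul_lie]; exact V.smul_mem a (hx v hv)
  | lie x y _ _ hx hy =>
    rw [lie_lie]; exact V.sub_mem (hx _ (hy v hv)) (hy _ (hx v hv))

lemma eq_top (S : IsSerreSystem K A e f h) (V : Submodule K L)
    (he : ∀ i, ∀ v ∈ V, ⁅e i, v⁆ ∈ V) (hf : ∀ i, ∀ v ∈ V, ⁅f i, v⁆ ∈ V)
    (he' : ∀ i, e i ∈ V) (hf' : ∀ i, f i ∈ V) : V = ⊤ := by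
  rw [eq_top_iff]
  rintro y -
  have hy : y ∈ LieSubalgebra.lieSpan K L (Set.range e ∪ Set.range f) := by simp [S.gen]
  induction hy using LieSubalgebra.lieSpan_induction with
  | mem x hx =>
    rcases hx with ⟨i, rfl⟩ | ⟨i, rfl⟩
    · exact he' i
    · exact hf' i
  | zero => simp
  | add x y _ _ hx hy => exact V.add_mem hx hy
  | smul a x _ hx => exact V.smul_mem a hx
  | lie x y _ _ hx hy => exact S.lie_mem V he hf _ _ hy

/-- The action of `e i` is locally nilpotent. -/
lemma exists_pow_eq_zero (S : IsSerreSystem K A e f h) (i : ι) (x : L) :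
    ∃ k : ℕ, ((LieAlgebra.ad K L (e i)) ^ k) x = 0 := by
  -- The elements killed by some power of `ad (e i)` form a subalgebra, so it is enough to test the
  -- generators.
  have key : LieSubalgebra.lieSpan K L (Set.range e ∪ Set.range f) ≤
      LieSubalgebra.engel K (e i) := by
    rw [LieSubalgebra.lieSpan_le]
    rintro _ (⟨j, rfl⟩ | ⟨j, rfl⟩)
    · rw [SetLike.mem_coe, LieSubalgebra.mem_engel_iff]
      by_cases hij : i = j
      · subst hij; exact ⟨1, by simp⟩
      · exact ⟨2, by simp [pow_succ, S.ee i j hij]⟩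
    · rw [SetLike.mem_coe, LieSubalgebra.mem_engel_iff]
      by_cases hij : i = j
      · subst hij
        refine ⟨3, ?_⟩
        have : ⁅e i, h i⁆ = -((A i i : K) • e i) := by rw [← lie_skew, S.he]
        simp [pow_succ, S.ef_self, this]
      · exact ⟨1, by simp [S.ef_ne i j hij]⟩
  rw [S.gen] at key
  exact (LieSubalgebra.mem_engel_iff K _ _).1 (key (LieSubalgebra.mem_top (R := K) x))

end General

/-! ### Weight decomposition and the sign of roots -/

section Weights

variable {K : Type*} [Field K] {ι L : Type*} [Fintype ι] [LieRing L]
  [LieAlgebra K L] {A : Matrix ι ι ℤ} {e f h : ι → L}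

lemma _root_.wtSpace_neg (γ : ι → ℤ) : wtSpace K A (-h) (-γ) = wtSpace K A h γ := by
  ext x
  refine forall_congr' fun i => ?_
  rw [Pi.neg_apply, neg_lie, Matrix.mulVec_neg, Pi.neg_apply, Int.cast_neg, neg_smul, neg_inj]

lemma _root_.lie_mem_wtSpace {γ δ : ι → ℤ} {x y : L} (hx : x ∈ wtSpace K A h γ)
    (hy : y ∈ wtSpace K A h δ) : ⁅x, y⁆ ∈ wtSpace K A h (γ + δ) := by
  intro i
  rw [leibniz_lie, hx i, hy i, Matrix.mulVec_add, smul_lie, lie_smul, ← add_smul]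
  simp

lemma h_mem (S : IsSerreSystem K A e f h) (i : ι) : h i ∈ wtSpace K A h 0 := by
  intro j
  simp [S.hh]

/-- The `ad (h i)` commute, so their joint eigenspaces are independent. Injectivity of `A` and
characteristic zero make distinct `γ` give distinct eigenvalue systems. -/
lemma iSupIndep_wtSpace [CharZero K] (S : IsSerreSystem K A e f h)
    (hA : Function.Injective A.mulVec) : iSupIndep (wtSpace K A h) := by
  have h0 : iSupIndep fun χ : ι → K =>
      ⨅ i, (LieAlgebra.ad K L (h i)).maxGenEigenspace (χ i) := by
    refine Module.End.independent_iInf_maxGenEigenspace_of_forall_mapsTo _ fun i j φ => ?_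
    apply Module.End.mapsTo_maxGenEigenspace_of_comm
    refine LinearMap.ext fun x => ?_
    simp only [Module.End.mul_apply, LieAlgebra.ad_apply]
    rw [leibniz_lie (h j) (h i) x, S.hh, zero_lie, zero_add]
  have hinj : Function.Injective fun (γ : ι → ℤ) (i : ι) => ((A.mulVec γ i : ℤ) : K) :=
    fun γ δ hγδ => hA (funext fun i => Int.cast_injective (α := K) (congrFun hγδ i))
  refine (h0.comp hinj).mono fun γ x hx => ?_
  refine (Submodule.mem_iInf _).2 fun i => ?_
  apply Module.End.eigenspace_le_maxGenEigenspace
  exact Module.End.mem_eigenspace_iff.2 (hx i)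

variable [DecidableEq ι]

lemma e_mem (S : IsSerreSystem K A e f h) (i : ι) : e i ∈ wtSpace K A h (Pi.single i 1) := by
  intro j
  simp [S.he]

lemma f_mem (S : IsSerreSystem K A e f h) (i : ι) : f i ∈ wtSpace K A h (-Pi.single i 1) := by
  have := S.flip.e_mem i
  rwa [← wtSpace_neg, neg_neg]

lemma mem_of_isMonomial (S : IsSerreSystem K A e f h) {γ : ι → ℤ} {x : L}
    (hx : IsMonomial e γ x) : x ∈ wtSpace K A h γ := by
  induction hx with
  | single i => exact S.e_mem i
  | cons i _ ih => rw [add_comm]; exact lie_mem_wtSpace (S.e_mem i) ih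

/-- Move `f j` inwards by the Jacobi identity: a matching letter turns into `-h j`, which acts by a
scalar on the rest of the word. An `h` itself survives only from a single letter; any further `e i`
outside turns it into a multiple of `e i`. -/
lemma f_lie_isMonomial (S : IsSerreSystem K A e f h) (j : ι) {γ : ι → ℤ} {x : L}
    (hx : IsMonomial e γ x) :
    ⁅f j, x⁆ ∈ Submodule.span K (Set.range h) ⊔ monomialSpan K e := by
  induction hx with
  | single i =>
    by_cases hij : j = i
    · subst hij
      rw [S.fe_self]
      exact Submodule.mem_sup_left (Submodule.neg_mem _ (Submodule.subset_span ⟨_, rfl⟩))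
    · rw [S.fe_ne _ _ hij]; exact Submodule.zero_mem _
  | @cons i γ x hx ih =>
    rw [leibniz_lie]
    apply Submodule.add_mem
    · by_cases hij : j = i
      · subst hij
        rw [S.fe_self, neg_lie, S.mem_of_isMonomial hx j]
        exact Submodule.mem_sup_right (Submodule.neg_mem _ (Submodule.smul_mem _ _
          (Submodule.subset_span ⟨_, hx⟩)))
      · rw [S.fe_ne _ _ hij, zero_lie]; exact Submodule.zero_mem _
    · have : Submodule.span K (Set.range h) ⊔ monomialSpan K e ≤
          (monomialSpan K e).comap (LieAlgebra.ad K L (e i)) := by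
        rw [sup_le_iff, Submodule.span_le]
        refine ⟨?_, fun y hy => lie_mem_monomialSpan i hy⟩
        rintro _ ⟨k, rfl⟩
        change ⁅e i, h k⁆ ∈ monomialSpan K e
        rw [← lie_skew, S.he]
        exact Submodule.neg_mem _ (Submodule.smul_mem _ _ (Submodule.subset_span ⟨_, .single i⟩))
      exact Submodule.mem_sup_right (this ih)

lemma f_lie_mem (S : IsSerreSystem K A e f h) (j : ι) {x : L}
    (hx : x ∈ Submodule.span K (Set.range h) ⊔ (monomialSpan K e ⊔ monomialSpan K f)) :
    ⁅f j, x⁆ ∈ Submodule.span K (Set.range h) ⊔ (monomialSpan K e ⊔ monomialSpan K f) := by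
  have : Submodule.span K (Set.range h) ⊔ (monomialSpan K e ⊔ monomialSpan K f) ≤
      (Submodule.span K (Set.range h) ⊔ (monomialSpan K e ⊔ monomialSpan K f)).comap
        (LieAlgebra.ad K L (f j)) := by
    refine sup_le ?_ (sup_le ?_ ?_)
    · rw [Submodule.span_le]
      rintro _ ⟨k, rfl⟩
      change ⁅f j, h k⁆ ∈ Submodule.span K (Set.range h) ⊔ (monomialSpan K e ⊔ monomialSpan K f)
      rw [← lie_skew, S.hf, neg_neg]
      exact Submodule.mem_sup_right (Submodule.mem_sup_right
        (Submodule.smul_mem _ _ (Submodule.subset_span ⟨_, .single j⟩)))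
    · rw [monomialSpan, Submodule.span_le]
      rintro x ⟨γ, hx⟩
      exact (sup_le_sup_left le_sup_left _ :
        Submodule.span K (Set.range h) ⊔ monomialSpan K e ≤ _) (S.f_lie_isMonomial j hx)
    · exact fun y hy => Submodule.mem_sup_right (Submodule.mem_sup_right
        (lie_mem_monomialSpan j hy))
  exact this hx

lemma e_lie_mem (S : IsSerreSystem K A e f h) (j : ι) {x : L}
    (hx : x ∈ Submodule.span K (Set.range h) ⊔ (monomialSpan K e ⊔ monomialSpan K f)) :
    ⁅e j, x⁆ ∈ Submodule.span K (Set.range h) ⊔ (monomialSpan K e ⊔ monomialSpan K f) := by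
  have h1 : Submodule.span K (Set.range (-h)) = Submodule.span K (Set.range h) := by
    apply le_antisymm <;> rw [Submodule.span_le] <;> rintro _ ⟨k, rfl⟩
    · exact Submodule.neg_mem _ (Submodule.subset_span ⟨k, rfl⟩)
    · rw [← neg_neg (h k)]
      exact Submodule.neg_mem _ (Submodule.subset_span ⟨k, rfl⟩)
  rw [sup_comm (monomialSpan K e), ← h1] at hx ⊢
  exact S.flip.f_lie_mem j hx

/-- The triangular decomposition. -/
lemma triangular (S : IsSerreSystem K A e f h) :
    Submodule.span K (Set.range h) ⊔ (monomialSpan K e ⊔ monomialSpan K f) = ⊤ :=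
  S.eq_top _ (fun j _ hx => S.e_lie_mem j hx) (fun j _ hx => S.f_lie_mem j hx)
    (fun i => Submodule.mem_sup_right (Submodule.mem_sup_left
      (Submodule.subset_span ⟨_, .single i⟩)))
    (fun i => Submodule.mem_sup_right (Submodule.mem_sup_right
      (Submodule.subset_span ⟨_, .single i⟩)))

/-- The spans on the right lie in the weight spaces and together exhaust `L` by the triangular
decomposition. As the weight spaces are independent, each inclusion is an equality. -/
lemma wtSpace_eq_span [CharZero K] (S : IsSerreSystem K A e f h)
    (hA : Function.Injective A.mulVec) (γ : ι → ℤ) :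
    wtSpace K A h γ = Submodule.span K
      {x | IsMonomial e γ x ∨ IsMonomial f (-γ) x ∨ (γ = 0 ∧ x ∈ Set.range h)} := by
  set U : (ι → ℤ) → Submodule K L := fun γ => Submodule.span K
      {x | IsMonomial e γ x ∨ IsMonomial f (-γ) x ∨ (γ = 0 ∧ x ∈ Set.range h)} with hU
  have hle : U ≤ wtSpace K A h := by
    intro γ
    rw [hU, Submodule.span_le]
    rintro x (hx | hx | ⟨rfl, i, rfl⟩)
    · exact S.mem_of_isMonomial hx
    · have := S.flip.mem_of_isMonomial hx
      rwa [wtSpace_neg] at this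
    · exact S.h_mem i
  have htop : ⨆ γ, U γ = ⊤ := by
    rw [eq_top_iff, ← S.triangular]
    refine sup_le ?_ (sup_le ?_ ?_) <;> [skip; unfold monomialSpan; unfold monomialSpan] <;>
      rw [Submodule.span_le]
    · exact fun x hx => Submodule.mem_iSup_of_mem 0 (Submodule.subset_span (.inr (.inr ⟨rfl, hx⟩)))
    · rintro x ⟨γ, hx⟩
      exact Submodule.mem_iSup_of_mem γ (Submodule.subset_span (.inl hx))
    · rintro x ⟨γ, hx⟩
      exact Submodule.mem_iSup_of_mem (-γ)
        (Submodule.subset_span (.inr (.inl (by rwa [neg_neg]))))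
  have := ((S.iSupIndep_wtSpace hA).le_iff_eq_of_iSup_eq_top htop).1 hle
  exact (congrFun this γ).symm

lemma nonneg_or_nonpos [CharZero K] (S : IsSerreSystem K A e f h)
    (hA : Function.Injective A.mulVec) {γ : ι → ℤ} {x : L} (hx : x ∈ wtSpace K A h γ)
    (hx0 : x ≠ 0) : 0 ≤ γ ∨ γ ≤ 0 := by
  by_contra! hγ
  apply hx0
  rw [S.wtSpace_eq_span hA] at hx
  have : {x | IsMonomial e γ x ∨ IsMonomial f (-γ) x ∨ (γ = 0 ∧ x ∈ Set.range h)} = ∅ := by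
    rw [Set.eq_empty_iff_forall_notMem]
    rintro y (hy | hy | ⟨hy, -⟩)
    · exact hγ.1 hy.nonneg
    · exact hγ.2 (neg_nonneg.1 hy.nonneg)
    · exact hγ.1 hy.ge
  rwa [this, Submodule.span_empty, Submodule.mem_bot] at hx

lemma of_support [CharZero K] (S : IsSerreSystem K A e f h)
    (hA : Function.Injective A.mulVec) {γ : ι → ℤ} (hγ : 0 ≤ γ) (hγ0 : γ ≠ 0) {i : ι}
    (hi : ∀ j, j ≠ i → γ j = 0) {x : L} (hx : x ∈ wtSpace K A h γ) (hx0 : x ≠ 0) :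
    γ = Pi.single i 1 ∧ x ∈ Submodule.span K {e i} := by
  rw [S.wtSpace_eq_span hA] at hx
  have key : ∀ y, (IsMonomial e γ y ∨ IsMonomial f (-γ) y ∨ (γ = 0 ∧ y ∈ Set.range h)) →
      y = 0 ∨ (γ = Pi.single i 1 ∧ y = e i) := by
    rintro y (hy | hy | ⟨hy, -⟩)
    · exact hy.of_support i hi
    · exact absurd (le_antisymm (neg_nonneg.1 hy.nonneg) hγ) hγ0
    · exact absurd hy hγ0
  by_cases h1 : γ = Pi.single i 1
  · refine ⟨h1, (Submodule.span_le.2 ?_) hx⟩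
    intro y hy
    rcases key y hy with rfl | ⟨-, rfl⟩
    · exact Submodule.zero_mem _
    · exact Submodule.mem_span_singleton_self _
  · refine absurd ?_ hx0
    rw [← Submodule.mem_bot K]
    refine (Submodule.span_le.2 ?_) hx
    intro y hy
    rcases key y hy with rfl | ⟨h2, -⟩
    · exact Submodule.zero_mem _
    · exact absurd h2 h1

end Weights

end IsSerreSystem

/-! ### The positive definite form on the root lattice -/

/-- Symmetric positive definite integral matrices with diagonal entries `2`. -/
structure IsPosDefCartan {ι : Type*} [Fintype ι] (A : Matrix ι ι ℤ) : Prop where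
  symm : A.transpose = A
  diag : ∀ i, A i i = 2
  pos : ∀ γ : ι → ℤ, γ ≠ 0 → 0 < γ ⬝ᵥ A.mulVec γ

namespace IsPosDefCartan

variable {ι : Type*} [Fintype ι] {A : Matrix ι ι ℤ}

lemma injective (hA : IsPosDefCartan A) : Function.Injective A.mulVec := by
  intro γ δ hγδ
  by_contra hne
  have := hA.pos _ (sub_ne_zero.2 hne)
  rw [Matrix.mulVec_sub, hγδ, sub_self, dotProduct_zero] at this
  exact this.false

lemma pairing_comm (hA : IsPosDefCartan A) (γ δ : ι → ℤ) :
    γ ⬝ᵥ A.mulVec δ = δ ⬝ᵥ A.mulVec γ := by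
  rw [Matrix.dotProduct_mulVec, dotProduct_comm, ← Matrix.mulVec_transpose, hA.symm]

/-- If `γ` and `δ` have norm `2` and `γ + δ ≠ 0`, then `2γ + δ` has norm greater than `2`. -/
lemma two_lt (hA : IsPosDefCartan A) {γ δ : ι → ℤ} (hγ : γ ⬝ᵥ A.mulVec γ = 2)
    (hδ : δ ⬝ᵥ A.mulVec δ = 2) (hne : γ ≠ -δ) :
    2 < (γ + (γ + δ)) ⬝ᵥ A.mulVec (γ + (γ + δ)) := by
  -- The norm `4 + 2(γ, δ)` of `γ + δ` is positive, so the integer `(γ, δ)` is at least `-1`.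
  have h1 := hA.pos (γ + δ) (fun h0 => hne (eq_neg_of_add_eq_zero_left h0))
  have h2 := hA.pairing_comm γ δ
  simp only [Matrix.mulVec_add, add_dotProduct, dotProduct_add] at h1 ⊢
  omega

lemma single_pairing [DecidableEq ι] (hA : IsPosDefCartan A) (i : ι) :
    Pi.single i 1 ⬝ᵥ A.mulVec (Pi.single i 1) = 2 := by
  simp [hA.diag]

/-- Simple reflections preserve the norm. -/
lemma reflection_pairing [DecidableEq ι] (hA : IsPosDefCartan A) (γ : ι → ℤ) (i : ι) :
    (γ - A.mulVec γ i • Pi.single i 1) ⬝ᵥ A.mulVec (γ - A.mulVec γ i • Pi.single i 1) =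
      γ ⬝ᵥ A.mulVec γ := by
  have h1 := hA.pairing_comm γ (Pi.single i 1)
  have h2 := hA.single_pairing i
  have h3 : Pi.single i 1 ⬝ᵥ A.mulVec γ = A.mulVec γ i := by simp
  simp only [Matrix.mulVec_sub, Matrix.mulVec_smul, sub_dotProduct, dotProduct_sub,
    smul_dotProduct, dotProduct_smul, h1, h2, h3, smul_eq_mul]
  ring

/-- A nonzero nonnegative vector pairs positively with a simple root from its support. -/
lemma exists_pos (hA : IsPosDefCartan A) {γ : ι → ℤ} (hγ : 0 ≤ γ) (hγ0 : γ ≠ 0) :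
    ∃ i, 0 < A.mulVec γ i := by
  by_contra! hcon
  have h1 := hA.pos γ hγ0
  have h2 : γ ⬝ᵥ A.mulVec γ ≤ 0 :=
    Finset.sum_nonpos fun i _ => mul_nonpos_of_nonneg_of_nonpos (hγ i) (hcon i)
  omega

end IsPosDefCartan

/-! ### Ideals and connectedness of the diagram -/

namespace IsSerreSystem

section Connected

variable {K : Type*} [Field K] [CharZero K] {ι L : Type*} [LieRing L] [LieAlgebra K L]
  {A : Matrix ι ι ℤ} {e f h : ι → L}

/-- If the index set is connected, a Lie ideal that contains some `e i` is everything. -/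
lemma eq_top_of_e_mem (S : IsSerreSystem K A e f h) (hA : ∀ i, A i i = 2)
    (hconn : ∀ s : Set ι, s.Nonempty → sᶜ.Nonempty → ∃ i ∈ s, ∃ j ∈ sᶜ, A i j ≠ 0)
    (V : Submodule K L) (hV : ∀ x : L, ∀ y ∈ V, ⁅x, y⁆ ∈ V) {i : ι} (hi : e i ∈ V) : V = ⊤ := by
  have hh : ∀ i, e i ∈ V → h i ∈ V := fun i hi => by
    rw [← neg_neg (h i), ← S.fe_self]
    exact V.neg_mem (hV _ _ hi)
  have hback : ∀ i (x : L) (c : K), h i ∈ V → c ≠ 0 → ⁅h i, x⁆ = c • x → x ∈ V := by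
    intro i x c hi hc hx
    rw [← inv_smul_smul₀ hc x, ← hx, ← lie_skew]
    exact V.smul_mem _ (V.neg_mem (hV _ _ hi))
  have he : ∀ j, e j ∈ V := by
    by_contra! hcon
    -- The set of `j` with `e j ∈ V` is closed under edges: `h a ∈ V` acts on `e b` by the nonzero
    -- scalar `A a b`.
    obtain ⟨a, ha, b, hb, hab⟩ := hconn {j | e j ∈ V} ⟨i, hi⟩ hcon
    exact hb (hback a (e b) _ (hh a ha) (Int.cast_ne_zero.2 hab) (S.he a b))
  refine S.eq_top V (fun _ _ hv => hV _ _ hv) (fun _ _ hv => hV _ _ hv) he fun j => ?_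
  refine hback j (f j) (-2) (hh j (he j)) (by simp) ?_
  rw [S.hf, hA]
  simp

/-- If `e i = 0`, the zero ideal contains `e i` and hence is all of `L`. -/
lemma e_ne_zero (S : IsSerreSystem K A e f h) (hA : ∀ i, A i i = 2)
    (hconn : ∀ s : Set ι, s.Nonempty → sᶜ.Nonempty → ∃ i ∈ s, ∃ j ∈ sᶜ, A i j ≠ 0)
    [Nontrivial L] (i : ι) : e i ≠ 0 := by
  intro h0
  refine bot_ne_top (α := Submodule K L) (S.eq_top_of_e_mem hA hconn ⊥ ?_ (i := i) (by simp [h0]))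
  rintro x y hy
  rw [(Submodule.mem_bot K).1 hy, lie_zero]
  exact Submodule.zero_mem _

end Connected

/-! ### Strings of the `sl₂`-triples and norms of roots -/

variable {K : Type*} [Field K] {ι L : Type*} [Fintype ι] [DecidableEq ι] [LieRing L]
  [LieAlgebra K L] {A : Matrix ι ι ℤ} {e f h : ι → L}

lemma f_pow_mem (S : IsSerreSystem K A e f h) (i : ι) {γ : ι → ℤ} {x : L}
    (hx : x ∈ wtSpace K A h γ) (m : ℕ) :
    ((LieAlgebra.ad K L (f i)) ^ m) x ∈ wtSpace K A h (γ - (m : ℤ) • Pi.single i 1) := by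
  induction m with
  | zero => simpa using hx
  | succ m ih =>
    rw [pow_succ', Module.End.mul_apply, LieAlgebra.ad_apply]
    have := lie_mem_wtSpace (S.f_mem i) ih
    convert this using 1
    push_cast
    rw [add_smul, one_smul]
    abel_nf

/-- This is the `sl₂` identity `[e, f^(m+1)] = (m+1) f^m (h - m)`, evaluated on a weight vector. -/
lemma e_lie_f_pow (S : IsSerreSystem K A e f h) {i : ι} (hi : A i i = 2) {γ : ι → ℤ} {x : L}
    (hx : x ∈ wtSpace K A h γ) (m : ℕ) :
    ⁅e i, ((LieAlgebra.ad K L (f i)) ^ (m + 1)) x⁆ =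
      ((LieAlgebra.ad K L (f i)) ^ (m + 1)) ⁅e i, x⁆ +
        (((m + 1) * (A.mulVec γ i - m) : ℤ) : K) • ((LieAlgebra.ad K L (f i)) ^ m) x := by
  induction m with
  | zero =>
    simp only [zero_add, pow_one, LieAlgebra.ad_apply, pow_zero, Module.End.one_apply]
    rw [leibniz_lie, S.ef_self, hx i, add_comm]
    simp
  | succ m ih =>
    have h1 := S.f_pow_mem i hx (m + 1) i
    rw [pow_succ' _ (m + 1), Module.End.mul_apply, LieAlgebra.ad_apply, leibniz_lie, S.ef_self,
      ih, h1, Module.End.mul_apply, LieAlgebra.ad_apply, lie_add, lie_smul,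
      ← LieAlgebra.ad_apply K L (f i) (((LieAlgebra.ad K L (f i)) ^ m) x), ← Module.End.mul_apply,
      ← pow_succ', Matrix.mulVec_sub, Matrix.mulVec_smul]
    rw [add_left_comm, ← add_smul]
    congr 2
    simp [hi]
    ring

variable [CharZero K]

/-- On a vector of weight `k ≥ m`, the operator `(ad (f i)) ^ m` is injective. -/
lemma eq_zero_of_f_pow (S : IsSerreSystem K A e f h) {i : ι} (hi : A i i = 2) {γ : ι → ℤ} {x : L}
    (hx : x ∈ wtSpace K A h γ) {m : ℕ} (hm : (m : ℤ) ≤ A.mulVec γ i)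
    (hf : ((LieAlgebra.ad K L (f i)) ^ m) x = 0) : x = 0 := by
  obtain ⟨r, hr⟩ := S.exists_pow_eq_zero i x
  induction r generalizing γ x m with
  | zero => simpa using hr
  | succ r ih =>
    -- Since `f^m x = 0`, the `sl₂` identity gives `f^(m+1) (e x) = 0`. The weight of `e x` is
    -- larger by 2 and its nilpotency exponent smaller by 1, so the induction applies to it.
    have hex : ⁅e i, x⁆ = 0 := by
      apply ih (m := m + 1) (lie_mem_wtSpace (S.e_mem i) hx)
      · rw [Matrix.mulVec_add]
        simp [hi]
        omega
      · have h1 := S.e_lie_f_pow hi hx m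
        rw [pow_succ', Module.End.mul_apply, hf] at h1
        simpa [← pow_succ'] using h1.symm
      · rwa [pow_succ, Module.End.mul_apply, LieAlgebra.ad_apply] at hr
    clear ih hr
    -- Now `x` is primitive, and `e f^(m+1) x = (m+1)(k-m) f^m x` has a nonzero coefficient because
    -- `m < k`; this strips off the powers of `f` one by one.
    induction m with
    | zero => simpa using hf
    | succ m ihm =>
      apply ihm (by push_cast at hm; omega)
      have h1 := S.e_lie_f_pow hi hx m
      rw [hf, hex, map_zero, lie_zero, zero_add] at h1
      refine (smul_eq_zero.1 h1.symm).resolve_left ?_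
      push_cast at hm
      refine Int.cast_ne_zero.2 (mul_ne_zero ?_ ?_) <;> omega

lemma f_lie_ne_zero (S : IsSerreSystem K A e f h) {i : ι} (hi : A i i = 2) {γ : ι → ℤ} {x : L}
    (hx : x ∈ wtSpace K A h γ) (hx0 : x ≠ 0) (hγ : 0 < A.mulVec γ i) : ⁅f i, x⁆ ≠ 0 :=
  fun h0 => hx0 (S.eq_zero_of_f_pow hi hx (m := 1) (by push_cast; omega) (by simpa using h0))

/-- If `γ` is a positive root other than `α_i`, then so is `γ - kα_i`, if it is a root. -/
lemma sub_nonneg_of_ne (S : IsSerreSystem K A e f h) (hA : IsPosDefCartan A) {γ : ι → ℤ}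
    {x y : L} (hγ : 0 ≤ γ) (hγ0 : γ ≠ 0) (hx : x ∈ wtSpace K A h γ) (hx0 : x ≠ 0) {i : ι}
    (hne : γ ≠ Pi.single i 1) {k : ℤ} (hy : y ∈ wtSpace K A h (γ - k • Pi.single i 1))
    (hy0 : y ≠ 0) : 0 ≤ γ - k • Pi.single i 1 ∧ γ - k • Pi.single i 1 ≠ 0 := by
  -- A positive root supported at `i` alone is `α_i`. Hence `γ` has another positive coordinate,
  -- which subtracting `kα_i` does not change, and a root has coordinates of one sign.
  have hsupp : ∃ j, j ≠ i ∧ γ j ≠ 0 := by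
    by_contra! hcon
    exact hne (S.of_support hA.injective hγ hγ0 hcon hx hx0).1
  obtain ⟨j, hji, hj⟩ := hsupp
  have hval : (γ - k • Pi.single i 1 : ι → ℤ) j = γ j := by simp [hji]
  have hpos : 0 < γ j := lt_of_le_of_ne (hγ j) (Ne.symm hj)
  refine ⟨(S.nonneg_or_nonpos hA.injective hy hy0).resolve_right fun hle => ?_, fun h0 => ?_⟩
  · have := hle j
    rw [hval, Pi.zero_apply] at this
    exact hpos.not_ge this
  · rw [h0, Pi.zero_apply] at hval
    exact hj hval.symm

/-- Induction on the height: a simple reflection that lowers the height keeps the norm and leads to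
another positive root, unless `γ` is simple. -/
lemma pairing_eq_two_of_nonneg (S : IsSerreSystem K A e f h) (hA : IsPosDefCartan A)
    {γ : ι → ℤ} {x : L} (hγ : 0 ≤ γ) (hγ0 : γ ≠ 0) (hx : x ∈ wtSpace K A h γ) (hx0 : x ≠ 0) :
    γ ⬝ᵥ A.mulVec γ = 2 := by
  obtain ⟨N, hN⟩ : ∃ N : ℕ, ∑ i, γ i ≤ N := ⟨_, Int.self_le_toNat _⟩
  induction N generalizing γ x with
  | zero =>
    refine absurd ?_ hγ0
    have h0 : ∑ i, γ i = 0 := le_antisymm hN (Finset.sum_nonneg fun i _ => hγ i)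
    exact funext fun i => (Finset.sum_eq_zero_iff_of_nonneg (fun i _ => hγ i)).1 h0 i
      (Finset.mem_univ i)
  | succ N ih =>
    obtain ⟨i, hi⟩ := hA.exists_pos hγ hγ0
    by_cases hne : γ = Pi.single i 1
    · rw [hne, hA.single_pairing]
    · have hk : ((A.mulVec γ i).toNat : ℤ) = A.mulVec γ i := Int.toNat_of_nonneg hi.le
      have hy := S.f_pow_mem i hx (A.mulVec γ i).toNat
      have hy0 : ((LieAlgebra.ad K L (f i)) ^ (A.mulVec γ i).toNat) x ≠ 0 :=
        fun h0 => hx0 (S.eq_zero_of_f_pow (hA.diag i) hx hk.le h0)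
      rw [hk] at hy
      obtain ⟨h1, h2⟩ := S.sub_nonneg_of_ne hA hγ hγ0 hx hx0 hne hy hy0
      rw [← hA.reflection_pairing γ i]
      refine ih h1 h2 hy hy0 ?_
      simp only [Pi.sub_apply, Pi.smul_apply, Finset.sum_sub_distrib, ← Finset.smul_sum]
      simp
      push_cast at hN
      omega

/-- All roots have norm `2`. -/
lemma pairing_eq_two (S : IsSerreSystem K A e f h) (hA : IsPosDefCartan A)
    {γ : ι → ℤ} {x : L} (hγ0 : γ ≠ 0) (hx : x ∈ wtSpace K A h γ) (hx0 : x ≠ 0) :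
    γ ⬝ᵥ A.mulVec γ = 2 := by
  rcases S.nonneg_or_nonpos hA.injective hx hx0 with hγ | hγ
  · exact S.pairing_eq_two_of_nonneg hA hγ hγ0 hx hx0
  · rw [← wtSpace_neg] at hx
    have := S.flip.pairing_eq_two_of_nonneg hA (neg_nonneg.2 hγ) (neg_ne_zero.2 hγ0) hx hx0
    simpa [Matrix.mulVec_neg] using this

/-- A nonzero double bracket would have degree `2γ + δ`, whose norm is too large for a root. -/
lemma lie_lie_eq_zero (S : IsSerreSystem K A e f h) (hA : IsPosDefCartan A) {γ δ : ι → ℤ}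
    {x y : L} (hγ0 : γ ≠ 0) (hδ0 : δ ≠ 0) (hx : x ∈ wtSpace K A h γ) (hy : y ∈ wtSpace K A h δ)
    (hne : γ ≠ -δ) : ⁅x, ⁅x, y⁆⁆ = 0 := by
  by_contra hcon
  have hx0 : x ≠ 0 := fun h0 => hcon (by simp [h0])
  have hy0 : y ≠ 0 := fun h0 => hcon (by simp [h0])
  have h1 := hA.two_lt (S.pairing_eq_two hA hγ0 hx hx0) (S.pairing_eq_two hA hδ0 hy hy0) hne
  rw [S.pairing_eq_two hA ?_ (lie_mem_wtSpace hx (lie_mem_wtSpace hx hy)) hcon] at h1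
  · exact h1.false
  · intro h0
    rw [h0, zero_dotProduct] at h1
    omega

/-- A Lie ideal that contains a nonzero vector of positive degree contains some `e i`. -/
lemma exists_e_mem (S : IsSerreSystem K A e f h) (hA : IsPosDefCartan A) (V : Submodule K L)
    (hV : ∀ i, ∀ y ∈ V, ⁅f i, y⁆ ∈ V) {γ : ι → ℤ} {x : L} (hγ : 0 ≤ γ) (hγ0 : γ ≠ 0)
    (hx : x ∈ wtSpace K A h γ) (hx0 : x ≠ 0) (hxV : x ∈ V) : ∃ i, e i ∈ V := by
  obtain ⟨N, hN⟩ : ∃ N : ℕ, ∑ i, γ i ≤ N := ⟨_, Int.self_le_toNat _⟩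
  induction N generalizing γ x with
  | zero =>
    refine absurd ?_ hγ0
    have h0 : ∑ i, γ i = 0 := le_antisymm hN (Finset.sum_nonneg fun i _ => hγ i)
    exact funext fun i => (Finset.sum_eq_zero_iff_of_nonneg (fun i _ => hγ i)).1 h0 i
      (Finset.mem_univ i)
  | succ N ih =>
    obtain ⟨i, hi⟩ := hA.exists_pos hγ hγ0
    by_cases hne : γ = Pi.single i 1
    · have hx' := (S.of_support hA.injective hγ hγ0 (i := i) (by simp +contextual [hne]) hx hx0).2
      obtain ⟨c, rfl⟩ := Submodule.mem_span_singleton.1 hx'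
      have hc : c ≠ 0 := fun h0 => hx0 (by simp [h0])
      exact ⟨i, by simpa [hc] using V.smul_mem c⁻¹ hxV⟩
    · have hy : ⁅f i, x⁆ ∈ wtSpace K A h (γ - (1 : ℤ) • Pi.single i 1) := by
        simpa using S.f_pow_mem i hx 1
      have hy0 := S.f_lie_ne_zero (hA.diag i) hx hx0 hi
      obtain ⟨h1, h2⟩ := S.sub_nonneg_of_ne hA hγ hγ0 hx hx0 hne hy hy0
      refine ih h1 h2 hy hy0 (hV i x hxV) ?_
      simp only [Pi.sub_apply, Pi.smul_apply, Finset.sum_sub_distrib, ← Finset.smul_sum]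
      simp
      push_cast at hN
      omega

/-! ### Generation by the `f i` and a highest weight vector -/

/-- The `f i` together with a highest weight vector of positive degree generate `L`. -/
lemma lieSpan_eq_top (S : IsSerreSystem K A e f h) (hA : IsPosDefCartan A)
    (hconn : ∀ s : Set ι, s.Nonempty → sᶜ.Nonempty → ∃ i ∈ s, ∃ j ∈ sᶜ, A i j ≠ 0)
    {θ : ι → ℤ} {x : L} (hθ : 0 ≤ θ) (hθ0 : θ ≠ 0) (hx : x ∈ wtSpace K A h θ) (hx0 : x ≠ 0)
    (hex : ∀ i, ⁅e i, x⁆ = 0) (M : LieSubalgebra K L) (hfM : ∀ i, f i ∈ M) (hxM : x ∈ M) :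
    M = ⊤ := by
  set T : Set L := {y | ∃ l : List ι, y = (l.map f).foldr (fun a b => ⁅a, b⁆) x}
  have hstep : ∀ i y, y ∈ T → ⁅f i, y⁆ ∈ T := by
    rintro i _ ⟨l, rfl⟩
    exact ⟨i :: l, rfl⟩
  set V := Submodule.span K T
  have hTM : V ≤ M.toSubmodule := by
    rw [Submodule.span_le]
    rintro _ ⟨l, rfl⟩
    induction l with
    | nil => exact hxM
    | cons i l ih => exact M.lie_mem (hfM i) ih
  -- Each word is a weight vector, so the term `⁅h i, w⁆` that arises when `e i` is moved past `f i`
  -- is a multiple of the shorter word `w`.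
  have hwt : ∀ l : List ι, ∃ γ, (l.map f).foldr (fun a b => ⁅a, b⁆) x ∈ wtSpace K A h γ := by
    intro l
    induction l with
    | nil => exact ⟨θ, hx⟩
    | cons i l ih =>
      obtain ⟨γ, hγ⟩ := ih
      exact ⟨_, lie_mem_wtSpace (S.f_mem i) hγ⟩
  have hVf : ∀ i, ∀ y ∈ V, ⁅f i, y⁆ ∈ V := by
    intro i
    have : V ≤ V.comap (LieAlgebra.ad K L (f i)) :=
      Submodule.span_le.2 fun y hy => Submodule.subset_span (hstep i y hy)
    exact fun y hy => this hy
  have hVe : ∀ i, ∀ y ∈ V, ⁅e i, y⁆ ∈ V := by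
    intro i
    have : V ≤ V.comap (LieAlgebra.ad K L (e i)) := by
      refine Submodule.span_le.2 ?_
      rintro _ ⟨l, rfl⟩
      change ⁅e i, (l.map f).foldr (fun a b => ⁅a, b⁆) x⁆ ∈ V
      induction l with
      | nil => rw [List.map_nil, List.foldr_nil, hex]; exact V.zero_mem
      | cons j l ih =>
        rw [List.map_cons, List.foldr_cons, leibniz_lie]
        refine V.add_mem ?_ (hVf j _ ih)
        by_cases hij : i = j
        · subst hij
          obtain ⟨γ, hγ⟩ := hwt l
          rw [S.ef_self, hγ i]
          exact V.smul_mem _ (Submodule.subset_span ⟨l, rfl⟩)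
        · rw [S.ef_ne i j hij, zero_lie]; exact V.zero_mem
    exact fun y hy => this hy
  obtain ⟨i, hi⟩ := S.exists_e_mem hA V hVf hθ hθ0 hx hx0 (Submodule.subset_span ⟨[], rfl⟩)
  have := S.eq_top_of_e_mem hA.diag hconn V (fun y v hv => S.lie_mem V hVe hVf y v hv) hi
  rw [this, top_le_iff] at hTM
  exact LieSubalgebra.toSubmodule_injective (by simpa using hTM)

end IsSerreSystem

/-! ### From finite type to positive definite -/

/-- Positive definiteness of a symmetrizable matrix that is already symmetric. -/
lemma IsFiniteType.pos {n : ℕ} {A : Matrix (Fin n) (Fin n) ℤ} (hfin : IsFiniteType A)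
    (hsymm : A.transpose = A) (γ : Fin n → ℤ) (hγ : γ ≠ 0) : 0 < γ ⬝ᵥ A.mulVec γ := by
  obtain ⟨d, hd, hpd⟩ := hfin
  have hcomm : ∀ i j, d i * (A i j : ℝ) = d j * (A i j : ℝ) := by
    intro i j
    have h1 := hpd.1.apply j i
    have h2 : A j i = A i j := congrFun (congrFun hsymm i) j
    simpa [Matrix.diagonal_mul, h2] using h1
  -- As `A` and `D A` are both symmetric, `d i = d j` whenever `A i j ≠ 0`. So evaluating `D A` at
  -- `D^(-1/2) γ` gives the form of `A` at `γ`.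
  set w : Fin n → ℝ := fun i => γ i / √(d i) with hw
  have hs : ∀ i, 0 < √(d i) := fun i => Real.sqrt_pos.2 (hd i)
  have hw0 : w ≠ 0 := by
    intro h0
    refine hγ (funext fun i => ?_)
    have := congrFun h0 i
    simpa [hw, (hs i).ne'] using this
  have h1 := hpd.dotProduct_mulVec_pos hw0
  have h2 : star w ⬝ᵥ (Matrix.diagonal d * A.map (fun a : ℤ => (a : ℝ))).mulVec w =
      ((γ ⬝ᵥ A.mulVec γ : ℤ) : ℝ) := by
    simp only [dotProduct, Matrix.mulVec, Pi.star_apply, star_trivial, Matrix.diagonal_mul,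
      Matrix.map_apply, Finset.mul_sum, Int.cast_sum, Int.cast_mul]
    refine Finset.sum_congr rfl fun i _ => Finset.sum_congr rfl fun j _ => ?_
    by_cases hij : (A i j : ℝ) = 0
    · simp [hij]
    · have hdd : d i = d j := mul_right_cancel₀ hij (hcomm i j)
      have hsq := Real.mul_self_sqrt (hd j).le
      have := (hs j).ne'
      simp only [hw, hdd]
      field_simp
      rw [pow_two, hsq]
  rw [h2] at h1
  exact_mod_cast h1

lemma isPosDefCartan_of_isFiniteType {n : ℕ} {A : Matrix (Fin n) (Fin n) ℤ} (hA : IsGCM A)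
    (hsl : A.IsSimplyLaced) (hfin : IsFiniteType A) : IsPosDefCartan A := by
  have hsymm : A.transpose = A := by
    ext i j
    rw [Matrix.transpose_apply]
    by_cases hij : i = j
    · rw [hij]
    · have h1 := hsl hij
      have h2 := hsl (Ne.symm hij)
      have h3 := hA.zero_iff i j hij
      omega
  exact ⟨hsymm, hA.diag, hfin.pos hsymm⟩

/-! ### The presented algebra as a Serre system -/

namespace KacMoody

variable (K : Type*) [Field K] {n : ℕ} (A : Matrix (Fin n) (Fin n) ℤ)

/-- The projection of the free Lie algebra onto `g(A)`. -/
def proj : FreeLieAlgebra K (CartanMatrix.Generators (Fin n)) →ₗ⁅K⁆ Matrix.ToLieAlgebra K A where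
  toFun x := LieSubmodule.Quotient.mk (N := CartanMatrix.Relations.toIdeal K A) x
  map_add' _ _ := rfl
  map_smul' _ _ := rfl
  map_lie' := rfl

/-- The Chevalley generators `e_i`. -/
def e (i : Fin n) : Matrix.ToLieAlgebra K A :=
  proj K A (FreeLieAlgebra.of K (CartanMatrix.Generators.E i))

lemma proj_surjective : Function.Surjective (proj K A) := Quot.mk_surjective

lemma proj_eq_zero {x : FreeLieAlgebra K (CartanMatrix.Generators (Fin n))}
    (hx : x ∈ CartanMatrix.Relations.toSet K A) : proj K A x = 0 :=
  LieSubmodule.Quotient.mk_eq_zero'.2 (LieSubmodule.subset_lieSpan hx)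

lemma proj_H (i : Fin n) :
    proj K A (FreeLieAlgebra.of K (CartanMatrix.Generators.H i)) = h K A i := rfl

lemma proj_E (i : Fin n) :
    proj K A (FreeLieAlgebra.of K (CartanMatrix.Generators.E i)) = e K A i := rfl

lemma proj_F (i : Fin n) :
    proj K A (FreeLieAlgebra.of K (CartanMatrix.Generators.F i)) = f K A i := rfl

/-- By the universal property, the lift of the generators to the subalgebra they span, followed by
the inclusion, is the identity. -/
lemma lieSpan_generators :
    LieSubalgebra.lieSpan K (FreeLieAlgebra K (CartanMatrix.Generators (Fin n)))
      (Set.range (FreeLieAlgebra.of K)) = ⊤ := by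
  set M := LieSubalgebra.lieSpan K (FreeLieAlgebra K (CartanMatrix.Generators (Fin n)))
    (Set.range (FreeLieAlgebra.of K))
  have h1 : M.incl.comp (FreeLieAlgebra.lift K
      fun i => (⟨FreeLieAlgebra.of K i, LieSubalgebra.subset_lieSpan ⟨i, rfl⟩⟩ : M)) =
      LieHom.id := by
    refine FreeLieAlgebra.hom_ext fun i => ?_
    rw [LieHom.comp_apply, FreeLieAlgebra.lift_of_apply]
    rfl
  rw [eq_top_iff]
  intro x _
  have h2 := LieHom.congr_fun h1 x
  rw [LieHom.comp_apply, LieHom.id_apply] at h2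
  rw [← h2]
  exact SetLike.coe_mem _

lemma isSerreSystem (hsl : A.IsSimplyLaced) :
    IsSerreSystem K A (e K A) (f K A) (h K A) where
  hh i j := by
    have := proj_eq_zero K A (x := CartanMatrix.Relations.HH K (i, j))
      (by simp [CartanMatrix.Relations.toSet])
    simpa [CartanMatrix.Relations.HH, proj_H] using this
  ef_self i := by
    have := proj_eq_zero K A (x := CartanMatrix.Relations.EF K (i, i))
      (by simp [CartanMatrix.Relations.toSet])
    simpa [CartanMatrix.Relations.EF, proj_H, proj_E, proj_F, sub_eq_zero] using this
  ef_ne i j hij := by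
    have := proj_eq_zero K A (x := CartanMatrix.Relations.EF K (i, j))
      (by simp [CartanMatrix.Relations.toSet])
    simpa [CartanMatrix.Relations.EF, proj_H, proj_E, proj_F, hij] using this
  he i j := by
    have := proj_eq_zero K A (x := CartanMatrix.Relations.HE K A (i, j))
      (by simp [CartanMatrix.Relations.toSet])
    simpa [CartanMatrix.Relations.HE, proj_H, proj_E, sub_eq_zero, Int.cast_smul_eq_zsmul]
      using this
  hf i j := by
    have := proj_eq_zero K A (x := CartanMatrix.Relations.HF K A (i, j))
      (by simp [CartanMatrix.Relations.toSet])
    simpa [CartanMatrix.Relations.HF, proj_H, proj_F, add_eq_zero_iff_eq_neg,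
      Int.cast_smul_eq_zsmul] using this
  ee i j hij := by
    have := proj_eq_zero K A (x := CartanMatrix.Relations.adE K A (i, j))
      (by simp [CartanMatrix.Relations.toSet])
    -- The Serre relation reads `⁅e i, e j⁆ = 0` if `A i j = 0` and `⁅e i, ⁅e i, e j⁆⁆ = 0` if `A i
    -- j = -1`; the double bracket vanishes in both cases.
    rcases hsl hij with h0 | h0 <;>
      simp [CartanMatrix.Relations.adE, proj_E, h0] at this <;> simp [this]
  ff i j hij := by
    have := proj_eq_zero K A (x := CartanMatrix.Relations.adF K A (i, j))
      (by simp [CartanMatrix.Relations.toSet])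
    rcases hsl hij with h0 | h0 <;>
      simp [CartanMatrix.Relations.adF, proj_F, h0] at this <;> simp [this]
  gen := by
    set M := LieSubalgebra.lieSpan K (Matrix.ToLieAlgebra K A)
      (Set.range (e K A) ∪ Set.range (f K A))
    have he : ∀ i, e K A i ∈ M := fun i => LieSubalgebra.subset_lieSpan (.inl ⟨i, rfl⟩)
    have hf : ∀ i, f K A i ∈ M := fun i => LieSubalgebra.subset_lieSpan (.inr ⟨i, rfl⟩)
    have hh : ∀ i, h K A i ∈ M := fun i => by
      have := proj_eq_zero K A (x := CartanMatrix.Relations.EF K (i, i))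
        (by simp [CartanMatrix.Relations.toSet])
      have h1 : ⁅e K A i, f K A i⁆ = h K A i := by
        simpa [CartanMatrix.Relations.EF, proj_H, proj_E, proj_F, sub_eq_zero] using this
      rw [← h1]
      exact M.lie_mem (he i) (hf i)
    have hle : LieSubalgebra.lieSpan K _ (Set.range (FreeLieAlgebra.of K)) ≤
        M.comap (proj K A) := by
      rw [LieSubalgebra.lieSpan_le]
      rintro _ ⟨i | i | i, rfl⟩
      · exact hh i
      · exact he i
      · exact hf i
    rw [lieSpan_generators, top_le_iff] at hle
    rw [eq_top_iff]
    intro x _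
    obtain ⟨y, rfl⟩ := proj_surjective K A x
    have : y ∈ M.comap (proj K A) := hle ▸ LieSubalgebra.mem_top y
    exact this

end KacMoody

/-! ### Maps out of the quantum minimal surface algebra -/

section Lift

variable {K : Type*} [Field K] {p q : ℕ} {μ : Fin (p + q) → K} {L : Type*} [LieRing L]
  [LieAlgebra K L]

/-- The universal property of the quantum minimal surface algebra. -/
lemma QMSA.exists_lift (y : Fin (p + q) → L)
    (hy : ∀ j, (∑ i : Fin p, ⁅y (Fin.castAdd q i), ⁅y (Fin.castAdd q i), y j⁆⁆)
      - (∑ i : Fin q, ⁅y (Fin.natAdd p i), ⁅y (Fin.natAdd p i), y j⁆⁆) - μ j • y j = 0) :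
    ∃ φ : QMSA K p q μ →ₗ⁅K⁆ L, ∀ i, φ (QMSA.gen K p q μ i) = y i := by
  set F := FreeLieAlgebra.lift K y with hF
  have hof : ∀ i, F (FreeLieAlgebra.of K i) = y i :=
    fun i => by rw [hF, FreeLieAlgebra.lift_of_apply]
  have hker : qmsaIdeal K p q μ ≤ F.ker := by
    refine LieSubmodule.lieSpan_le.2 ?_
    rintro _ ⟨j, rfl⟩
    rw [SetLike.mem_coe, LieHom.mem_ker]
    simpa [qmsaRel, hof] using hy j
  let φ : QMSA K p q μ →ₗ⁅K⁆ L :=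
    { (qmsaIdeal K p q μ).toSubmodule.liftQ
      (F : FreeLieAlgebra K (Fin (p + q)) →ₗ[K] L) (fun _ hx => hker hx) with
      map_lie' := by
        intro x y
        obtain ⟨x, rfl⟩ := LieSubmodule.Quotient.surjective_mk' _ x
        obtain ⟨y, rfl⟩ := LieSubmodule.Quotient.surjective_mk' _ y
        exact F.map_lie x y }
  exact ⟨φ, fun i => hof i⟩

end Lift

end

/-! ### The main theorem -/

theorem mainTheorem2 {K : Type*} [RCLike K] {n : ℕ} (hn : 2 ≤ n)
    (A : Matrix (Fin n) (Fin n) ℤ) (hA : IsGCM A) (hsl : A.IsSimplyLaced)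
    (hfin : IsFiniteType A) (hirr : IsIndecomposableMatrix A)
    (p q m : ℕ) (hm : 1 ≤ m) (hpq : p + q = n + m)
    (θ : Fin n → ℤ) (hθ : KacMoody.IsHighestRoot K A θ)
    (eθ : Matrix.ToLieAlgebra K A) (heθ : eθ ∈ KacMoody.rootSpace K A θ) (heθ0 : eθ ≠ 0)
    (β : Fin (m - 1) → Fin n → ℤ) (hβ : ∀ j, β j ∈ KacMoody.roots K A)
    (hβθ : ∀ j, β j ≠ -θ) (hβα : ∀ j i, β j ≠ KacMoody.simpleRoot i)
    (hββ : ∀ i j, i ≠ j → β i ≠ -β j)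
    (eβ : Fin (m - 1) → Matrix.ToLieAlgebra K A)
    (heβ : ∀ j, eβ j ∈ KacMoody.rootSpace K A (β j)) :
    ∃ φ : QMSA K p q (fun _ => 0) →ₗ⁅K⁆ Matrix.ToLieAlgebra K A,
      Function.Surjective φ ∧
      (∀ i : Fin n, φ (QMSA.gen K p q (fun _ => 0) ⟨i, by omega⟩) = KacMoody.f K A i) ∧
      φ (QMSA.gen K p q (fun _ => 0) ⟨n, by omega⟩) = eθ ∧
      ∀ j : Fin (m - 1),
        φ (QMSA.gen K p q (fun _ => 0) ⟨n + 1 + j, by omega⟩) = eβ j := by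
  have S := KacMoody.isSerreSystem K A hsl
  have hP := isPosDefCartan_of_isFiniteType hA hsl hfin
  have : Nontrivial (Matrix.ToLieAlgebra K A) := ⟨eθ, 0, heθ0⟩
  have hroot : ∀ (γ : Fin n → ℤ) (x : Matrix.ToLieAlgebra K A), γ ≠ 0 →
      x ∈ wtSpace K A (KacMoody.h K A) γ → x ≠ 0 → γ ∈ KacMoody.roots K A :=
    fun γ x hγ hx hx0 => ⟨hγ, (Submodule.ne_bot_iff _).2 ⟨x, hx, hx0⟩⟩
  have hαθ : ∀ i j, (Pi.single i 1 : Fin n → ℤ) j ≤ θ j := fun i =>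
    hθ.2 _ (hroot _ _ (by simp) (S.e_mem i) (S.e_ne_zero hP.diag hirr i))
  have hθpos : ∀ i, 0 < θ i := fun i => by
    have := hαθ i i
    rw [Pi.single_eq_same] at this
    omega
  -- Here `n ≥ 2` matters: `θ` has full support, so it is not simple. For `n = 1` the degrees `θ`
  -- and `-α_1` would be opposite.
  have hθα : ∀ i, θ ≠ Pi.single i 1 := by
    rintro i rfl
    have : Nontrivial (Fin n) := Fin.nontrivial_iff_two_le.2 hn
    obtain ⟨j, hj⟩ := exists_ne i
    have := hθpos j
    simp [hj] at this
  -- Otherwise `α_i + θ` would be a root exceeding `θ` in the coordinate `i`.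
  have hex : ∀ i, ⁅KacMoody.e K A i, eθ⁆ = 0 := by
    intro i
    by_contra hcon
    have hmem := lie_mem_wtSpace (S.e_mem i) heθ
    have h0 : Pi.single i 1 + θ ≠ 0 := fun h0 => by
      have := congrFun h0 i
      have := hθpos i
      simp at *
      omega
    have := hθ.2 _ (hroot _ _ h0 hmem hcon) i
    simp at this
  -- The images of the generators and their degrees.
  let y : Fin (p + q) → Matrix.ToLieAlgebra K A := fun i =>
    if h1 : i.1 < n then KacMoody.f K A ⟨i, h1⟩
    else if h2 : i.1 = n then eθ else eβ ⟨i.1 - (n + 1), by omega⟩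
  let d : Fin (p + q) → Fin n → ℤ := fun i =>
    if h1 : i.1 < n then -Pi.single ⟨i, h1⟩ 1
    else if h2 : i.1 = n then θ else β ⟨i.1 - (n + 1), by omega⟩
  have hyd : ∀ i, y i ∈ wtSpace K A (KacMoody.h K A) (d i) := by
    intro i
    simp only [y, d]
    split_ifs with h1 h2
    · exact S.f_mem _
    · exact heθ
    · exact heβ _
  have hd0 : ∀ i, d i ≠ 0 := by
    intro i
    simp only [d]
    split_ifs with h1 h2
    · simp
    · exact hθ.1.1
    · exact (hβ _).1
  have hself : ∀ γ : Fin n → ℤ, γ = -γ → γ = 0 := fun γ hγ => self_eq_neg.1 hγ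
  -- For `i = j` this holds because a nonzero degree is not its own negative. The other cases pair
  -- up the three kinds of degree `-α_i`, `θ`, `β_j`.
  have hdd : ∀ i j, d i ≠ -d j := by
    intro i j hij
    by_cases hne : i = j
    · subst hne; exact hd0 i (hself _ hij)
    simp only [d] at hij
    split_ifs at hij with h1 h2 h3 h4 h5 h6 h7 h8
    · have := congrFun hij ⟨i, h1⟩
      have h0 : 0 ≤ (Pi.single ⟨j, h2⟩ 1 : Fin n → ℤ) ⟨i, h1⟩ := by
        rw [Pi.single_apply]; split_ifs <;> simp
      simp at this
      omega
    · exact hθα _ (neg_injective hij).symm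
    · exact hβα _ _ (neg_injective hij).symm
    · exact hθα _ (by simpa using hij)
    · exact hθ.1.1 (hself _ hij)
    · exact hβθ _ (by rw [hij, neg_neg])
    · exact hβα _ ⟨j, h7⟩ (by rw [hij, neg_neg]; rfl)
    · exact hβθ _ hij
    · refine hββ _ _ ?_ hij
      intro h0
      apply hne
      rw [Fin.mk.injEq] at h0
      ext
      omega
  have hyy : ∀ i j, ⁅y i, ⁅y i, y j⁆⁆ = 0 := fun i j =>
    S.lie_lie_eq_zero hP (hd0 i) (hd0 j) (hyd i) (hyd j) (hdd i j)
  obtain ⟨φ, hφ⟩ := QMSA.exists_lift (K := K) (μ := fun _ => 0) y (fun j => by simp [hyy])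
  have hφf : ∀ i : Fin n, φ (QMSA.gen K p q (fun _ => 0) ⟨i, by omega⟩) = KacMoody.f K A i :=
    fun i => by rw [hφ]; simp [y]
  have hφθ : φ (QMSA.gen K p q (fun _ => 0) ⟨n, by omega⟩) = eθ := by rw [hφ]; simp [y]
  refine ⟨φ, ?_, hφf, hφθ, fun j => ?_⟩
  · rw [← LieHom.range_eq_top]
    refine S.lieSpan_eq_top hP hirr (fun i => (hθpos i).le) hθ.1.1 heθ heθ0 hex _ ?_ ?_
    · exact fun i => ⟨_, hφf i⟩
    · exact ⟨_, hφθ⟩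
  · rw [hφ]
    have h1 : ¬ n + 1 + j.1 < n := by omega
    have h2 : ¬ n + 1 + j.1 = n := by omega
    simp [y, h1, h2]
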